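/- Let $A$ be a commutative unital ring with total quotient ring $Q(A)$ (the localisation of $A$ at the set of its non-zero-divisors). For an $A$-module $M$, write $M_{\mathrm{tor}}$ for the submodule of elements annihilated by some non-zero-divisor of $A$, set $M_{\mathrm{tf}} := M/M_{\mathrm{tor}}$, call $M$ torsion if $M = M_{\mathrm{tor}}$, and let $\mathcal{P}(M)$ be the (possibly empty) set of prime ideals $\mathfrak{p}$ of $A$ of height one with $(M_{\mathrm{tor}})_{\mathfrak{p}} \neq 0$. Consider the following properties: - (P$_1$) for every prime ideal $\mathfrak{p}$ of $A$ that is maximal amongst the prime ideals contained in $\bigcup_{\mathfrak{q} \in \mathcal{P}(M)} \mathfrak{q}$, the localisation $A_{\mathfrak{p}}$ is a valuation ring, in the sense that its ideals are linearly ordered by inclusion; - (P$_2$) $\mathcal{P}(M)$ is finite and every prime ideal in $\mathcal{P}(M)$ is finitely generated. A finitely generated $A$-module is amenable if it satisfies (P$_1$) and (P$_2$). An $A$-module is pseudo-null if its localisation at every prime ideal of height at most one vanishes, and a homomorphism of $A$-modules is a pseudo-isomorphism if its kernel and cokernel are pseudo-null. **Theorem.** Let $M$ be a finitely presented $A$-module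 with property (P$_1$). (i) If $M$ is torsion, then there exist an $A$-module $N$, a finite family of principal ideals $\{L_\tau\}_{\tau \in \mathcal{T}}$ of $A$ and a pseudo-isomorphism of $A$-modules $$M \oplus N \to \bigoplus_{\tau \in \mathcal{T}} A/L_\tau.$$ (ii) If $Q(A)$ is semisimple, then the following hold. (a) If $M$ is both amenable and torsion, then there exist a finite set $\mathcal{T}$, prime ideals $\mathfrak{p}_\tau \in \mathcal{P}(M)$ and integers $e_\tau \geq 1$ for $\tau \in \mathcal{T}$, and a pseudo-isomorphism of $A$-modules $$M \to \bigoplus_{\tau \in \mathcal{T}} A/\mathfrak{p}_\tau^{e_\tau}.$$ (b) In general (that is, without assuming $M$ torsion or amenable), there exists a pseudo-isomorphism of $A$-modules $M \to M_{\mathrm{tor}} \oplus M_{\mathrm{tf}}$. -/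

import Mathlib

open scoped DirectSum

universe u v w

namespace NonNoeth

section Modules

variable (A : Type u) [CommRing A] (M : Type v) [AddCommGroup M] [Module A M]

/-- The set `𝒫(M)` of height one primes of `A` in the support of the torsion submodule
`M_tor = {m | a m = 0 for some non-zero-divisor a of A}`. -/
def heightOneTorsionSupport : Set (PrimeSpectrum A) :=
  {p | p.asIdeal.height = 1 ∧ p ∈ Module.support A (Submodule.torsion A M)}

/-- A valuation ring in the sense that its ideals are linearly ordered by inclusion
(zero-divisors are allowed). -/
def IdealsLinearlyOrdered (R : Type u) [CommRing R] : Prop :=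
  ∀ I J : Ideal R, I ≤ J ∨ J ≤ I

/-- Property (P₁): `A_p` is a valuation ring for every prime `p` that is maximal amongst the primes
contained in the union of the primes in `𝒫(M)`. -/
def PropertyP1 : Prop :=
  ∀ p : PrimeSpectrum A,
    Maximal (fun p' : PrimeSpectrum A =>
      (p'.asIdeal : Set A) ⊆ ⋃ q ∈ heightOneTorsionSupport A M, (q.asIdeal : Set A)) p →
    IdealsLinearlyOrdered (Localization.AtPrime p.asIdeal)

/-- Property (P₂): `𝒫(M)` is finite and consists of finitely generated primes. -/
def PropertyP2 : Prop :=
  (heightOneTorsionSupport A M).Finite ∧ ∀ p ∈ heightOneTorsionSupport A M, p.asIdeal.FG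

/-- Amenable modules. -/
structure IsAmenable : Prop where
  finite : Module.Finite A M
  p1 : PropertyP1 A M
  p2 : PropertyP2 A M

/-- Pseudo-null modules: the localisation at every prime of height at most one vanishes. -/
def IsPseudoNull : Prop :=
  ∀ p : PrimeSpectrum A, p.asIdeal.height ≤ 1 →
    Subsingleton (LocalizedModule p.asIdeal.primeCompl M)

end Modules

/-- Pseudo-isomorphisms: the kernel and the cokernel are pseudo-null. -/
def IsPseudoIso {A : Type u} [CommRing A] {M : Type v} [AddCommGroup M] [Module A M]
    {N : Type w} [AddCommGroup N] [Module A N] (f : M →ₗ[A] N) : Prop :=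
  IsPseudoNull A (LinearMap.ker f) ∧ IsPseudoNull A (N ⧸ LinearMap.range f)

end NonNoeth

/-!
Localised at a prime occurring in property (P₁), a finitely presented module is a finite direct sum
of cyclic modules `R / (r)`: over a ring with linearly ordered ideals, some entry of a matrix of
relations divides all the others and so splits off a cyclic summand
(`IdealsLinearlyOrdered.exists_equiv_pi`). By finite presentation such a decomposition descends to
maps over `A` whose composites are multiplication by an element outside the prime
(`exists_comp_eq_smul_of_equiv_pi`).

Passing from these primes to all of `𝒫(M)` at once uses no localisation at the union of the primes
in `𝒫(M)`. For a submodule `E` of `End M`, the scalars acting on `M` as an element of `E` form an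
ideal. If this ideal lies in none of the primes maximal in that union, then it contains some `s`
outside every member of `𝒫(M)` (`PropertyP1.exists_smul_id_mem`). Multiplication by `s` is
invertible at the primes of `𝒫(M)`, while at the other primes of height at most one `M_tor`
vanishes (`exists_smul_eq_zero_of_notMem`).

* Let `E` be spanned by the endomorphisms factoring through some `A / (a)`. Then `s = π ∘ σ` for
  maps `σ : M → ⨁ A / (a_i)` and `π` back. For `M` torsion and `N = ker π`, the map
  `(σ, inclusion)` on `M × N` is a pseudo-isomorphism.
* Let `E` be the sum of the endomorphisms with torsion image and those killing `M_tor`. If `Q(A)`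
  is semisimple, then every element of `A` that is nonzero in `A_P` divides, up to an element
  outside `P`, a non-zero-divisor (`exists_mul_eq_zero_or_exists_mul_eq`). A map factoring through
  `A / (a)` therefore lies in `E` up to such an element, and `s = ρ + g` with `ρ : M → M_tor`
  and `g` zero on `M_tor`. The pseudo-isomorphism is `ρ` together with the quotient map.
* If `M` is amenable and `Q(A)` is semisimple, then `A_p` is a discrete valuation ring for each `p`
  in the finite set `𝒫(M)`, the cyclic summands are `A_p / p ^ e`, and the local decompositions
  can be put side by side, because `A / q ^ e` vanishes at every other prime of height at most one.
-/

namespace NonNoeth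

/-! ### Finitely presented modules over a ring with linearly ordered ideals -/

section Chain

variable {R : Type u} [CommRing R]

lemma IdealsLinearlyOrdered.dvd_total (h : IdealsLinearlyOrdered R) (a b : R) : a ∣ b ∨ b ∣ a := by
  simpa only [Ideal.span_singleton_le_span_singleton, or_comm] using
    h (Ideal.span {a}) (Ideal.span {b})

lemma IdealsLinearlyOrdered.exists_dvd_all (h : IdealsLinearlyOrdered R) {s : Finset R}
    (hs : s.Nonempty) : ∃ a ∈ s, ∀ b ∈ s, a ∣ b := by
  classical
  induction hs using Finset.Nonempty.cons_induction with
  | singleton a => exact ⟨a, by simp⟩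
  | cons c s hc hs ih =>
    obtain ⟨a, ha, hab⟩ := ih
    rcases h.dvd_total a c with hac | hca
    · exact ⟨a, by simp [ha], by simpa [hac] using hab⟩
    · exact ⟨c, by simp, by simpa using fun b hb ↦ hca.trans (hab b hb)⟩

lemma IdealsLinearlyOrdered.isPrincipal_of_fg (h : IdealsLinearlyOrdered R) {I : Ideal R}
    (hI : I.FG) : I.IsPrincipal := by
  classical
  obtain ⟨s, rfl⟩ := hI
  obtain rfl | hs := s.eq_empty_or_nonempty
  · simpa using (inferInstance : (⊥ : Ideal R).IsPrincipal)
  obtain ⟨a, ha, hab⟩ := h.exists_dvd_all hs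
  refine ⟨a, le_antisymm (Ideal.span_le.mpr fun b hb ↦ ?_) ?_⟩
  · exact Ideal.mem_span_singleton.mpr (hab b hb)
  · exact Ideal.span_mono (by simpa using ha)

/-- A reduced ring with linearly ordered ideals has no zero-divisors: if `a * b = 0` and
`a ∣ b`, then `b ^ 2 = 0`. -/
lemma IdealsLinearlyOrdered.isDomain [IsReduced R] [Nontrivial R] (h : IdealsLinearlyOrdered R) :
    IsDomain R := by
  have : NoZeroDivisors R := by
    refine ⟨fun {a b} hab ↦ ?_⟩
    rcases h.dvd_total a b with ⟨c, rfl⟩ | ⟨c, rfl⟩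
    · exact .inr (pow_eq_zero_iff two_ne_zero |>.mp (by linear_combination c * hab))
    · exact .inl (pow_eq_zero_iff two_ne_zero |>.mp (by linear_combination c * hab))
  exact NoZeroDivisors.to_isDomain R

/-- A finitely generated submodule `K` of `R ^ (n + 1)` contains a multiple `a • v` of a vector
having a coordinate equal to one, where `a` divides all coordinates of all elements of `K`: an
entry of a generator that divides all the others will do. -/
lemma IdealsLinearlyOrdered.exists_pivot (h : IdealsLinearlyOrdered R) {n : ℕ}
    {K : Submodule R (Fin (n + 1) → R)} (hK : K.FG) :
    ∃ (a : R) (i : Fin (n + 1)) (v : Fin (n + 1) → R), v i = 1 ∧ a • v ∈ K ∧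
      ∀ k ∈ K, ∀ j, a ∣ k j := by
  classical
  obtain ⟨s, rfl⟩ := hK
  obtain rfl | hs := s.eq_empty_or_nonempty
  · exact ⟨0, 0, 1, rfl, by simp, by simp⟩
  obtain ⟨a, ha, hdvd⟩ := h.exists_dvd_all
    (s := (s ×ˢ (Finset.univ : Finset (Fin (n + 1)))).image fun p ↦ p.1 p.2)
    ((hs.product Finset.univ_nonempty).image _)
  obtain ⟨⟨g, i⟩, hg, rfl⟩ := Finset.mem_image.mp ha
  have hgs : g ∈ s := (Finset.mem_product.mp hg).1
  have hd : ∀ k ∈ s, ∀ j, g i ∣ k j := fun k hk j ↦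
    hdvd _ (Finset.mem_image.mpr ⟨(k, j), by simp [hk], rfl⟩)
  choose c hc using hd g hgs
  refine ⟨g i, i, Function.update c i 1, by simp, ?_, fun k hk j ↦ ?_⟩
  · have : g i • Function.update c i 1 = g := by
      ext j
      obtain rfl | hj := eq_or_ne j i
      · simp
      · simpa [hj] using (hc j).symm
    rw [this]
    exact Submodule.subset_span hgs
  · have hle : Submodule.span R (s : Set (Fin (n + 1) → R)) ≤
        Submodule.comap (LinearMap.proj j : (Fin (n + 1) → R) →ₗ[R] R) (Ideal.span {g i}) :=
      Submodule.span_le.mpr fun k hk ↦ Ideal.mem_span_singleton.mpr (hd k hk j)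
    exact Ideal.mem_span_singleton.mp (hle hk)

/-- A retraction `σ` of `ι : P → M` splits `M` as `P × M / ι(P)`. -/
noncomputable def prodQuotientRangeEquiv {M : Type v} {P : Type w} [AddCommGroup M] [Module R M]
    [AddCommGroup P] [Module R P] (ι : P →ₗ[R] M) (σ : M →ₗ[R] P) (h : ∀ y, σ (ι y) = y) :
    M ≃ₗ[R] P × (M ⧸ LinearMap.range ι) :=
  LinearEquiv.ofBijective (σ.prod (LinearMap.range ι).mkQ) <| by
    constructor
    · refine (injective_iff_map_eq_zero _).mpr fun m hm ↦ ?_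
      obtain ⟨h1, h2⟩ := Prod.ext_iff.mp hm
      obtain ⟨y, rfl⟩ := (Submodule.Quotient.mk_eq_zero _).mp h2
      have : y = 0 := (h y).symm.trans h1
      simp [this]
    · rintro ⟨y, q⟩
      obtain ⟨m, rfl⟩ := Submodule.mkQ_surjective _ q
      refine ⟨m + ι (y - σ m), Prod.ext (by simp [h]) ?_⟩
      exact (Submodule.Quotient.eq _).mpr ⟨y - σ m, by abel⟩

/-- A finitely presented module over a ring with linearly ordered ideals is a finite direct sum of
cyclic modules `R / (r)` with `r` a non-unit. The induction on the number of generators splits off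
the cyclic summand given by `exists_pivot` for the module of relations. -/
theorem IdealsLinearlyOrdered.exists_equiv_pi_of_span (h : IdealsLinearlyOrdered R) (n : ℕ) :
    ∀ (M : Type v) [AddCommGroup M] [Module R M] [Module.FinitePresentation R M] (x : Fin n → M),
      Submodule.span R (Set.range x) = ⊤ →
      ∃ (m : ℕ) (r : Fin m → R), (∀ i, ¬ IsUnit (r i)) ∧
        Nonempty (M ≃ₗ[R] Π i, R ⧸ Ideal.span {r i}) := by
  induction n with
  | zero =>
    intro M _ _ _ x hx
    have : Subsingleton M := by
      rw [← Submodule.subsingleton_iff R, ← subsingleton_iff_bot_eq_top, ← hx]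
      simp
    exact ⟨0, Fin.elim0, fun i ↦ i.elim0, ⟨0⟩⟩
  | succ n ih =>
    intro M _ _ _ x hx
    let f : (Fin (n + 1) → R) →ₗ[R] M := Fintype.linearCombination R x
    have hf : Function.Surjective f := by
      rw [← LinearMap.range_eq_top, Fintype.range_linearCombination, hx]
    obtain ⟨a, i, v, hvi, hav, hdvd⟩ := h.exists_pivot (Module.FinitePresentation.fg_ker f hf)
    let σ : M →ₗ[R] R ⧸ Ideal.span {a} :=
      (LinearMap.ker f).liftQ ((Ideal.span {a}).mkQ ∘ₗ LinearMap.proj i) (fun k hk ↦ by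
        simpa [Ideal.Quotient.eq_zero_iff_mem, Ideal.mem_span_singleton] using hdvd k hk i) ∘ₗ
      (f.quotKerEquivOfSurjective hf).symm.toLinearMap
    have hσ (w) : σ (f w) = Ideal.Quotient.mk _ (w i) := by
      have : (f.quotKerEquivOfSurjective hf).symm (f w) = Submodule.Quotient.mk w := by
        rw [LinearEquiv.symm_apply_eq]; rfl
      simp only [σ, LinearMap.comp_apply, LinearEquiv.coe_coe, this]
      rfl
    let ι : (R ⧸ Ideal.span {a}) →ₗ[R] M :=
      (Ideal.span {a}).liftQ (LinearMap.toSpanSingleton R M (f v)) (by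
        rw [Ideal.span, Submodule.span_singleton_le_iff_mem, LinearMap.mem_ker,
          LinearMap.toSpanSingleton_apply, ← map_smul]
        exact hav)
    have hι (c : R) : ι (Ideal.Quotient.mk _ c) = c • f v := rfl
    have hσι (y) : σ (ι y) = y := by
      obtain ⟨c, rfl⟩ := Ideal.Quotient.mk_surjective y
      rw [hι, ← map_smul, hσ]
      simp [hvi]
    let E := prodQuotientRangeEquiv ι σ hσι
    have hfp : Module.FinitePresentation R (M ⧸ LinearMap.range ι) := by
      refine Module.finitePresentation_of_surjective (LinearMap.range ι).mkQ
        (Submodule.mkQ_surjective _) ?_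
      rw [Submodule.ker_mkQ, LinearMap.range_eq_map]
      exact Module.Finite.fg_top.map _
    obtain ⟨m, r, hr, ⟨e⟩⟩ := ih (M ⧸ LinearMap.range ι)
        (fun j ↦ Submodule.Quotient.mk (x (i.succAbove j))) (by
      have htop : Submodule.map (LinearMap.range ι).mkQ (Submodule.span R (Set.range x)) = ⊤ := by
        rw [hx, Submodule.map_top, Submodule.range_mkQ]
      rw [← top_le_iff, ← htop, Submodule.map_span, Submodule.span_le]
      rintro _ ⟨_, ⟨j, rfl⟩, rfl⟩
      have key (j : Fin n) : (Submodule.Quotient.mk (x (i.succAbove j)) : M ⧸ LinearMap.range ι) ∈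
          Submodule.span R (Set.range fun j ↦ (Submodule.Quotient.mk (x (i.succAbove j)) :
            M ⧸ LinearMap.range ι)) := Submodule.subset_span ⟨j, rfl⟩
      rcases Fin.eq_self_or_eq_succAbove i j with rfl | ⟨j, rfl⟩
      · have h0 : (LinearMap.range ι).mkQ (f v) = 0 :=
          (Submodule.Quotient.mk_eq_zero _).mpr ⟨Ideal.Quotient.mk _ 1, by rw [hι, one_smul]⟩
        rw [Fintype.linearCombination_apply, Fin.sum_univ_succAbove _ j, hvi, one_smul, map_add,
          map_sum, add_eq_zero_iff_eq_neg] at h0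
        rw [h0]
        exact neg_mem (Submodule.sum_mem _ fun l _ ↦ by
          rw [map_smul]; exact Submodule.smul_mem _ _ (key l))
      · exact key j)
    by_cases ha : IsUnit a
    · have : Subsingleton (R ⧸ Ideal.span {a}) := by
        rw [Ideal.Quotient.subsingleton_iff, Ideal.span_singleton_eq_top]; exact ha
      have : Unique (R ⧸ Ideal.span {a}) := ⟨⟨0⟩, fun _ ↦ Subsingleton.elim _ _⟩
      exact ⟨m, r, hr, ⟨E ≪≫ₗ LinearEquiv.uniqueProd ≪≫ₗ e⟩⟩
    · refine ⟨m + 1, Fin.cons a r, Fin.cases ha hr, ⟨E ≪≫ₗ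
        (LinearEquiv.refl R _).prodCongr e ≪≫ₗ
        Fin.consLinearEquiv R fun k ↦ R ⧸ Ideal.span {(Fin.cons a r : Fin (m + 1) → R) k}⟩⟩

theorem IdealsLinearlyOrdered.exists_equiv_pi (h : IdealsLinearlyOrdered R)
    (M : Type v) [AddCommGroup M] [Module R M] [Module.FinitePresentation R M] :
    ∃ (m : ℕ) (r : Fin m → R), (∀ i, ¬ IsUnit (r i)) ∧
      Nonempty (M ≃ₗ[R] Π i, R ⧸ Ideal.span {r i}) := by
  obtain ⟨n, x, hx⟩ := Submodule.fg_iff_exists_fin_generating_family.mp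
    (Module.Finite.fg_top (R := R) (M := M))
  exact h.exists_equiv_pi_of_span n M x hx

end Chain

/-! ### Descending isomorphisms from a localisation -/

section Descent

variable {A : Type u} [CommRing A]

/-- An isomorphism between localisations of finitely presented modules is induced, up to an element
of the multiplicative set, by a pair of maps that are mutually inverse up to that element. -/
lemma exists_comp_eq_smul_of_localized_equiv (S : Submonoid A)
    {M N M' N' : Type*} [AddCommGroup M] [Module A M] [AddCommGroup N] [Module A N]
    [AddCommGroup M'] [Module A M'] [AddCommGroup N'] [Module A N']
    [Module.FinitePresentation A M] [Module.FinitePresentation A N]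
    (k : M →ₗ[A] M') [IsLocalizedModule S k] (l : N →ₗ[A] N') [IsLocalizedModule S l]
    (e : M' ≃ₗ[A] N') :
    ∃ (φ : M →ₗ[A] N) (ψ : N →ₗ[A] M), ∃ s ∈ S,
      (∀ m, ψ (φ m) = s • m) ∧ ∀ n, φ (ψ n) = s • n := by
  obtain ⟨φ, s, hφ⟩ := Module.FinitePresentation.exists_lift_of_isLocalizedModule S l
    (e.toLinearMap ∘ₗ k)
  obtain ⟨ψ, t, hψ⟩ := Module.FinitePresentation.exists_lift_of_isLocalizedModule S k
    (e.symm.toLinearMap ∘ₗ l)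
  replace hφ (m) : l (φ m) = (s : A) • e (k m) := LinearMap.congr_fun hφ m
  replace hψ (n) : k (ψ n) = (t : A) • e.symm (l n) := LinearMap.congr_fun hψ n
  obtain ⟨w, hw⟩ := Module.Finite.exists_smul_of_comp_eq_of_isLocalizedModule S k
    (ψ ∘ₗ φ) (((t : A) * s) • LinearMap.id) (by ext m; simp [hφ, hψ, mul_smul])
  obtain ⟨w', hw'⟩ := Module.Finite.exists_smul_of_comp_eq_of_isLocalizedModule S l
    (φ ∘ₗ ψ) (((t : A) * s) • LinearMap.id)
    (by ext n; simp [hφ, hψ, mul_smul, smul_comm (s : A) (t : A)])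
  replace hw (m) : (w : A) • ψ (φ m) = (w : A) • ((t : A) * s) • m := LinearMap.congr_fun hw m
  replace hw' (n) : (w' : A) • φ (ψ n) = (w' : A) • ((t : A) * s) • n :=
    LinearMap.congr_fun hw' n
  refine ⟨φ, ((w : A) * w') • ψ, (w * w' * (t * s) : S), SetLike.coe_mem _, fun m ↦ ?_,
    fun n ↦ ?_⟩
  · rw [LinearMap.smul_apply, mul_comm, mul_smul, hw, smul_smul, smul_smul]
    congr 1
    push_cast
    ring
  · rw [LinearMap.smul_apply, map_smul, mul_smul, hw', smul_smul, smul_smul]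
    congr 1

lemma exists_isLocalizedModule_quotient (P : Ideal A) [P.IsPrime] (I : Ideal A) :
    ∃ l : (A ⧸ I) →ₗ[A] (Localization.AtPrime P ⧸ I.map (algebraMap A (Localization.AtPrime P))),
      IsLocalizedModule P.primeCompl l := by
  rw [← Ideal.localized'_eq_map (Localization.AtPrime P) P.primeCompl I]
  exact ⟨Submodule.toLocalizedQuotient' (Localization.AtPrime P) P.primeCompl
    (Algebra.linearMap A (Localization.AtPrime P)) I, inferInstance⟩

/-- A decomposition of `M_P` into cyclic modules `A_P / I A_P` comes from maps over `A` that are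
mutually inverse up to an element outside `P`. -/
lemma exists_comp_eq_smul_of_equiv_pi (P : Ideal A) [P.IsPrime] {M : Type v} [AddCommGroup M]
    [Module A M] [Module.FinitePresentation A M] {n : ℕ} (I : Fin n → Ideal A)
    (hI : ∀ i, (I i).FG)
    (e : LocalizedModule P.primeCompl M ≃ₗ[Localization.AtPrime P] Π i,
      Localization.AtPrime P ⧸ (I i).map (algebraMap A (Localization.AtPrime P))) :
    ∃ (φ : M →ₗ[A] Π i, A ⧸ I i) (ψ : (Π i, A ⧸ I i) →ₗ[A] M), ∃ s ∉ P,
      (∀ m, ψ (φ m) = s • m) ∧ ∀ n, φ (ψ n) = s • n := by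
  choose l hl using fun i ↦ exists_isLocalizedModule_quotient P (I i)
  have hfp (i) : Module.FinitePresentation A (A ⧸ I i) :=
    Module.finitePresentation_of_surjective (I i).mkQ (Submodule.mkQ_surjective _)
      (by rw [Submodule.ker_mkQ]; exact hI i)
  exact exists_comp_eq_smul_of_localized_equiv P.primeCompl
    (LocalizedModule.mkLinearMap P.primeCompl M) (.pi fun i ↦ l i ∘ₗ .proj i)
    (e.restrictScalars A)

/-- At a prime `P` where the localisation of `A` has linearly ordered ideals, a finitely presented
module is, up to an element outside `P`, a direct sum of modules `A / (a)`. -/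
lemma exists_comp_eq_smul_of_idealsLinearlyOrdered (P : Ideal A) [P.IsPrime]
    (hP : IdealsLinearlyOrdered (Localization.AtPrime P))
    (M : Type v) [AddCommGroup M] [Module A M] [Module.FinitePresentation A M] :
    ∃ (n : ℕ) (a : Fin n → A) (φ : M →ₗ[A] Π i, A ⧸ Ideal.span {a i})
      (ψ : (Π i, A ⧸ Ideal.span {a i}) →ₗ[A] M), ∃ s ∉ P, ∀ m, ψ (φ m) = s • m := by
  obtain ⟨n, r, -, ⟨e⟩⟩ := hP.exists_equiv_pi (LocalizedModule P.primeCompl M)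
  have hr (i) : ∃ a : A, Ideal.span {r i} =
      (Ideal.span {a}).map (algebraMap A (Localization.AtPrime P)) := by
    obtain ⟨⟨a, s⟩, ha⟩ := IsLocalization.surj P.primeCompl (r i)
    refine ⟨a, ?_⟩
    rw [Ideal.map_span, Set.image_singleton, ← ha, Ideal.span_singleton_mul_right_unit]
    exact IsLocalization.map_units _ s
  choose a ha using hr
  obtain ⟨φ, ψ, s, hs, h, -⟩ := exists_comp_eq_smul_of_equiv_pi P (M := M)
    (fun i ↦ Ideal.span {a i}) (fun i ↦ ⟨{a i}, by simp [Ideal.span]⟩)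
    (e ≪≫ₗ LinearEquiv.piCongrRight fun i ↦ Submodule.quotEquivOfEq _ _ (ha i))
  exact ⟨n, a, φ, ψ, s, hs, h⟩

lemma smul_id_eq_sum {M : Type*} [AddCommGroup M] [Module A M] {ι : Type*} [Fintype ι]
    [DecidableEq ι] {N : ι → Type*} [∀ i, AddCommGroup (N i)] [∀ i, Module A (N i)]
    (φ : M →ₗ[A] Π i, N i) (ψ : (Π i, N i) →ₗ[A] M) {s : A} (h : ∀ m, ψ (φ m) = s • m) :
    s • LinearMap.id = ∑ i, (ψ ∘ₗ LinearMap.single A N i) ∘ₗ (LinearMap.proj i ∘ₗ φ) := by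
  ext m
  simp only [LinearMap.smul_apply, LinearMap.id_apply, LinearMap.sum_apply,
    LinearMap.comp_apply, LinearMap.proj_apply, ← map_sum, LinearMap.coe_single,
    Finset.univ_sum_single, h]

end Descent

/-! ### Primes of height at most one and the torsion submodule -/

section Primes

variable {A : Type u} [CommRing A] {M : Type v} [AddCommGroup M] [Module A M]

lemma isPseudoIso_of_forall {N : Type w} [AddCommGroup N] [Module A N] (f : M →ₗ[A] N)
    (hker : ∀ p : PrimeSpectrum A, p.asIdeal.height ≤ 1 → ∀ m, f m = 0 →
      ∃ s ∉ p.asIdeal, s • m = 0)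
    (hcoker : ∀ p : PrimeSpectrum A, p.asIdeal.height ≤ 1 → ∀ y, ∃ s ∉ p.asIdeal, ∃ m, f m = s • y) :
    IsPseudoIso f := by
  refine ⟨fun p hp ↦ LocalizedModule.subsingleton_iff.mpr fun m ↦ ?_,
    fun p hp ↦ LocalizedModule.subsingleton_iff.mpr fun y ↦ ?_⟩
  · obtain ⟨s, hs, h⟩ := hker p hp m m.2
    exact ⟨s, hs, Subtype.ext h⟩
  · obtain ⟨y, rfl⟩ := Submodule.mkQ_surjective _ y
    obtain ⟨s, hs, m, h⟩ := hcoker p hp y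
    exact ⟨s, hs, (Submodule.Quotient.mk_eq_zero _).mpr ⟨m, h⟩⟩

lemma IsPseudoIso.linearEquiv_comp {N : Type w} {N' : Type*} [AddCommGroup N] [Module A N]
    [AddCommGroup N'] [Module A N'] {f : M →ₗ[A] N} (hf : IsPseudoIso f) (e : N ≃ₗ[A] N') :
    IsPseudoIso (e.toLinearMap ∘ₗ f) := by
  refine isPseudoIso_of_forall _ (fun p hp m hm ↦ ?_) fun p hp y ↦ ?_
  · obtain ⟨s, hs, h⟩ := LocalizedModule.subsingleton_iff.mp (hf.1 p hp) ⟨m, by simpa using hm⟩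
    exact ⟨s, hs, congrArg Subtype.val h⟩
  · obtain ⟨s, hs, h⟩ := LocalizedModule.subsingleton_iff.mp (hf.2 p hp)
      (Submodule.Quotient.mk (e.symm y))
    obtain ⟨m, hm⟩ := (Submodule.Quotient.mk_eq_zero _).mp h
    exact ⟨s, hs, m, by simp [hm]⟩

/-- Torsion elements die at a prime of height at most one outside `𝒫(M)`: for height one this is the
definition of `𝒫(M)`, and minimal primes contain no non-zero-divisors. -/
lemma exists_smul_eq_zero_of_notMem (p : PrimeSpectrum A) (hp : p.asIdeal.height ≤ 1)
    (hpM : p ∉ heightOneTorsionSupport A M) {m : M} (hm : m ∈ Submodule.torsion A M) :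
    ∃ s ∉ p.asIdeal, s • m = 0 := by
  by_cases h1 : p.asIdeal.height = 1
  · have : p ∉ Module.support A (Submodule.torsion A M) := fun h ↦ hpM ⟨h1, h⟩
    obtain ⟨s, hs, h⟩ :=
      LocalizedModule.subsingleton_iff.mp (Module.notMem_support_iff.mp this) ⟨m, hm⟩
    exact ⟨s, hs, congrArg Subtype.val h⟩
  · have h0 : p.asIdeal.height = 0 := Order.lt_one_iff.mp (lt_of_le_of_ne hp h1)
    obtain ⟨a, ha⟩ := (Submodule.mem_torsion_iff m).mp hm
    exact ⟨a, fun hap ↦ Set.disjoint_left.mp (Ideal.disjoint_nonZeroDivisors_of_mem_minimalPrimes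
      (Ideal.height_eq_zero_iff.mp h0)) hap a.2, ha⟩

lemma eq_of_le_of_height_le_one {p q : PrimeSpectrum A} (hq : q.asIdeal.height = 1)
    (hp : p.asIdeal.height ≤ 1) (h : q.asIdeal ≤ p.asIdeal) : q = p := by
  have : q.asIdeal.FiniteHeight := ⟨.inr (by simp [hq])⟩
  exact PrimeSpectrum.ext (Ideal.eq_of_le_of_height_le _ h (hp.trans hq.ge))

/-- An ideal contained in no prime maximal in the union of the primes in `T` has an element outside
all of them: an ideal maximal amongst those contained in the union is prime. -/
lemma exists_mem_forall_notMem (T : Set (PrimeSpectrum A)) (J : Ideal A)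
    (hJ : ∀ P : PrimeSpectrum A, Maximal (fun p' : PrimeSpectrum A =>
      (p'.asIdeal : Set A) ⊆ ⋃ q ∈ T, (q.asIdeal : Set A)) P → ¬ J ≤ P.asIdeal) :
    ∃ s ∈ J, ∀ q ∈ T, s ∉ q.asIdeal := by
  by_contra! hcon
  let S : Submonoid A := ⨅ q ∈ T, q.asIdeal.primeCompl
  have hS (I : Ideal A) : Disjoint (I : Set A) S ↔ (I : Set A) ⊆ ⋃ q ∈ T, (q.asIdeal : Set A) := by
    simp [Set.disjoint_left, Set.subset_def, S, Ideal.mem_primeCompl_iff]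
  obtain ⟨P, hJP, hP⟩ := zorn_le_nonempty₀ {I : Ideal A | Disjoint (I : Set A) S}
    (fun c hc hchain y hy ↦ ⟨sSup c, by
      refine Set.disjoint_left.mpr ?_
      intro x hx
      obtain ⟨I, hI, hxI⟩ := (Submodule.mem_sSup_of_directed ⟨y, hy⟩ hchain.directedOn).mp hx
      exact Set.disjoint_left.mp (hc hI) hxI, fun z hz ↦ le_sSup hz⟩) J
    ((hS J).mpr fun s hs ↦ by simpa using hcon s hs)
  have hprime : P.IsPrime := Ideal.isPrime_of_maximally_disjoint P S hP.prop fun I hI h ↦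
    hI.not_ge (hP.le_of_ge h hI.le)
  exact hJ ⟨P, hprime⟩ ⟨(hS P).mp hP.prop, fun p' hp' hle ↦ hP.le_of_ge ((hS _).mpr hp') hle⟩ hJP

/-- The scalars acting as an element of a submodule `E` of `End M` form an ideal, so that
`exists_mem_forall_notMem` reduces the existence of one outside all primes of `𝒫(M)` to the primes
in property (P₁). -/
lemma PropertyP1.exists_smul_id_mem (hP1 : PropertyP1 A M) (E : Submodule A (M →ₗ[A] M))
    (hE : ∀ (P : Ideal A) [P.IsPrime], IdealsLinearlyOrdered (Localization.AtPrime P) →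
      ∃ s ∉ P, s • LinearMap.id ∈ E) :
    ∃ s : A, s • LinearMap.id ∈ E ∧ ∀ q ∈ heightOneTorsionSupport A M, s ∉ q.asIdeal := by
  refine exists_mem_forall_notMem _ (E.comap (LinearMap.toSpanSingleton A _ LinearMap.id))
    fun P hP hle ↦ ?_
  obtain ⟨s, hs, h⟩ := hE P.asIdeal (hP1 P hP)
  exact hs (hle h)

end Primes

/-! ### Torsion modules as summands of sums of cyclic modules -/

section Torsion

variable {A : Type u} [CommRing A] {M : Type v} [AddCommGroup M] [Module A M]

/-- The submodule of `End M` spanned by the maps that factor through some `A / (a)` contains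
multiplication by some `s` outside all primes of `𝒫(M)`. -/
lemma PropertyP1.exists_comp_eq_smul (hP1 : PropertyP1 A M) [Module.FinitePresentation A M] :
    ∃ (n : ℕ) (a : Fin n → A) (σ : M →ₗ[A] Π i, A ⧸ Ideal.span {a i})
      (π : (Π i, A ⧸ Ideal.span {a i}) →ₗ[A] M) (s : A),
      (∀ m, π (σ m) = s • m) ∧ ∀ q ∈ heightOneTorsionSupport A M, s ∉ q.asIdeal := by
  let F : Set (M →ₗ[A] M) := {g | ∃ (a : A) (σ : M →ₗ[A] A ⧸ Ideal.span {a})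
    (π : (A ⧸ Ideal.span {a}) →ₗ[A] M), g = π ∘ₗ σ}
  obtain ⟨s, hsF, hs⟩ := hP1.exists_smul_id_mem (Submodule.span A F) fun P _ hP ↦ by
    obtain ⟨n, a, φ, ψ, s, hs, h⟩ := exists_comp_eq_smul_of_idealsLinearlyOrdered P hP M
    refine ⟨s, hs, ?_⟩
    rw [smul_id_eq_sum φ ψ h]
    exact Submodule.sum_mem _ fun i _ ↦ Submodule.subset_span ⟨a i, _, _, rfl⟩
  obtain ⟨n, c, g, hg⟩ := Submodule.mem_span_set'.mp hsF
  choose a σ π hσπ using fun i ↦ (g i).2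
  refine ⟨n, a, .pi σ, ∑ i, c i • π i ∘ₗ .proj i, s, fun m ↦ ?_, hs⟩
  have := LinearMap.congr_fun hg m
  simp only [hσπ] at this
  simpa using this

/-- With `π ∘ σ` equal to multiplication by `s`, the map `(σ, inclusion)` from `M × ker π` is an
isomorphism wherever `s` is invertible, and also wherever `M` vanishes. -/
theorem exists_prod_pseudoIso_of_isTorsion [Module.FinitePresentation A M]
    (hP1 : PropertyP1 A M) (hM : Module.IsTorsion A M) :
    ∃ (N : Type u) (_ : AddCommGroup N) (_ : Module A N) (n : ℕ) (L : Fin n → Ideal A)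
      (f : (M × N) →ₗ[A] ⨁ τ : Fin n, (A ⧸ L τ)),
      (∀ τ, (L τ).IsPrincipal) ∧ IsPseudoIso f := by
  obtain ⟨n, a, σ, π, s, hπσ, hs⟩ := hP1.exists_comp_eq_smul
  have hkill (p : PrimeSpectrum A) (hp : p.asIdeal.height ≤ 1)
      (hpM : p ∉ heightOneTorsionSupport A M) (m : M) : ∃ t ∉ p.asIdeal, t • m = 0 :=
    exists_smul_eq_zero_of_notMem p hp hpM ((Submodule.mem_torsion_iff m).mpr (@hM m))
  have hf : IsPseudoIso (σ.coprod (LinearMap.ker π).subtype) := by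
    refine isPseudoIso_of_forall _ (fun p hp ↦ ?_) fun p hp y ↦ ?_
    · rintro ⟨m, x, hx⟩ h0
      replace h0 : σ m + x = 0 := h0
      obtain ⟨t, ht, htm⟩ : ∃ t ∉ p.asIdeal, t • m = 0 := by
        by_cases hpM : p ∈ heightOneTorsionSupport A M
        · refine ⟨s, hs p hpM, ?_⟩
          rw [← hπσ, eq_neg_of_add_eq_zero_left h0, map_neg, LinearMap.mem_ker.mp hx, neg_zero]
        · exact hkill p hp hpM m
      refine ⟨t, ht, Prod.ext htm (Subtype.ext ?_)⟩
      change t • x = 0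
      rw [eq_neg_of_add_eq_zero_right h0, smul_neg, ← map_smul, htm, map_zero, neg_zero]
    · by_cases hpM : p ∈ heightOneTorsionSupport A M
      · refine ⟨s, hs p hpM, (π y, ⟨s • y - σ (π y), ?_⟩), by simp⟩
        simp [hπσ]
      · obtain ⟨t, ht, h⟩ := hkill p hp hpM (π y)
        exact ⟨t, ht, (0, ⟨t • y, by simp [h]⟩), by simp⟩
  exact ⟨LinearMap.ker π, inferInstance, inferInstance, n, fun i ↦ Ideal.span {a i}, _,
    fun i ↦ ⟨a i, rfl⟩,
    hf.linearEquiv_comp (DirectSum.linearEquivFunOnFintype A (Fin n) _).symm⟩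

end Torsion

/-! ### Splitting off the torsion submodule -/

section Splitting

variable {A : Type u} [CommRing A] {M : Type v} [AddCommGroup M] [Module A M]

lemma isReduced_of_isSemisimpleRing_fractionRing [IsSemisimpleRing (FractionRing A)] :
    IsReduced A :=
  isReduced_of_injective (algebraMap A (FractionRing A)) (IsFractionRing.injective A _)

/-- If `Q(A)` is semisimple, then `a` can be completed to a non-zero-divisor `a * d + c` with
`a * c = 0`: the ideal of `Q(A)` generated by `a` is generated by an idempotent `e`, and
`a + (1 - e)` is invertible. -/
lemma exists_mul_add_mem_nonZeroDivisors [IsSemisimpleRing (FractionRing A)] (a : A) :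
    ∃ c d : A, a * c = 0 ∧ a * d + c ∈ nonZeroDivisors A := by
  let α := algebraMap A (FractionRing A)
  have hinj : Function.Injective α := IsFractionRing.injective A _
  obtain ⟨e, he, hae⟩ := IsSemisimpleRing.ideal_eq_span_idempotent (Ideal.span {α a})
  obtain ⟨y, hy⟩ := Ideal.mem_span_singleton.mp (hae.le (Ideal.mem_span_singleton_self _))
  obtain ⟨x, hx⟩ := Ideal.mem_span_singleton.mp (hae.ge (Ideal.mem_span_singleton_self _))
  obtain ⟨⟨c, d⟩, hcd⟩ := IsLocalization.surj (nonZeroDivisors A) (1 - e)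
  replace hcd : (1 - e) * α d = α c := hcd
  replace he : e * e = e := he
  have hz : α a * (1 - e) = 0 := by rw [hy]; linear_combination -y * he
  refine ⟨c, d, hinj ?_, mem_nonZeroDivisors_iff_right.mpr fun z hzb ↦ ?_⟩
  · rw [map_mul, ← hcd, map_zero]
    linear_combination α d * hz
  · have h1 : α z * α d * (α a + (1 - e)) = 0 := by
      have := congrArg α hzb
      simp only [map_mul, map_add, map_zero, ← hcd] at this
      linear_combination this
    have h2 : (α a + (1 - e)) * (x * e + (1 - e)) = 1 := by
      linear_combination hz - e * hx + (2 - x) * he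
    have h3 : α (z * d) = 0 := by
      rw [map_mul]
      linear_combination (x * e + (1 - e)) * h1 - α z * α d * h2
    exact (mem_nonZeroDivisors_iff_right.mp d.2) z (hinj (h3.trans (map_zero α).symm))

/-- Up to an element outside `P`, an element `a` of `A` vanishes or divides a non-zero-divisor. With
`a * d + c` as in `exists_mul_add_mem_nonZeroDivisors`, one of `a` and `c` vanishes in the domain
`A_P`. -/
lemma exists_mul_eq_zero_or_exists_mul_eq [IsSemisimpleRing (FractionRing A)] (P : Ideal A)
    [P.IsPrime] (hP : IdealsLinearlyOrdered (Localization.AtPrime P)) (a : A) :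
    ∃ u ∉ P, u * a = 0 ∨ ∃ b ∈ nonZeroDivisors A, a ∣ u * b := by
  have : IsReduced A := isReduced_of_isSemisimpleRing_fractionRing
  have : IsDomain (Localization.AtPrime P) := hP.isDomain
  obtain ⟨c, d, hac, hb⟩ := exists_mul_add_mem_nonZeroDivisors a
  have h0 : algebraMap A (Localization.AtPrime P) a * algebraMap A _ c = 0 := by
    rw [← map_mul, hac, map_zero]
  rcases mul_eq_zero.mp h0 with h | h
  · obtain ⟨u, hu⟩ := (IsLocalization.map_eq_zero_iff P.primeCompl _ _).mp h
    exact ⟨u, u.2, .inl hu⟩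
  · obtain ⟨u, hu⟩ := (IsLocalization.map_eq_zero_iff P.primeCompl _ _).mp h
    exact ⟨u, u.2, .inr ⟨_, hb, u * d, by linear_combination hu⟩⟩

/-- Up to an element outside `P`, an endomorphism factoring through `A / (a)` either has torsion
image or kills the torsion submodule. -/
lemma exists_smul_comp_mem_sup [IsSemisimpleRing (FractionRing A)] (P : Ideal A)
    [P.IsPrime] (hP : IdealsLinearlyOrdered (Localization.AtPrime P)) (a : A)
    (σ : M →ₗ[A] A ⧸ Ideal.span {a}) (π : (A ⧸ Ideal.span {a}) →ₗ[A] M) :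
    ∃ u ∉ P, u • π ∘ₗ σ ∈ Submodule.compatibleMaps ⊤ (Submodule.torsion A M) ⊔
      Submodule.compatibleMaps (Submodule.torsion A M) (⊥ : Submodule A M) := by
  obtain ⟨u, hu, h | ⟨b, hb, c, hc⟩⟩ := exists_mul_eq_zero_or_exists_mul_eq P hP a
  · refine ⟨u, hu, Submodule.mem_sup_right fun m hm ↦ ?_⟩
    obtain ⟨⟨b, hb⟩, hbm⟩ := (Submodule.mem_torsion_iff m).mp hm
    obtain ⟨x, hx⟩ := Ideal.Quotient.mk_surjective (σ m)
    have hbx : a ∣ b * x := by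
      rw [← Ideal.mem_span_singleton, ← Ideal.Quotient.eq_zero_iff_mem, map_mul, hx]
      exact (map_smul σ b m).symm.trans (by rw [show b • m = 0 from hbm, map_zero])
    obtain ⟨z, hz⟩ := hbx
    have hux : u * x = 0 := (mem_nonZeroDivisors_iff_right.mp hb) _
      (by linear_combination u * hz + z * h)
    have : u • σ m = 0 := by
      rw [← hx]
      change Ideal.Quotient.mk _ (u * x) = 0
      rw [hux, map_zero]
    simp [← map_smul, this]
  · refine ⟨u, hu, Submodule.mem_sup_left fun m _ ↦
      (Submodule.mem_torsion_iff _).mpr ⟨⟨b, hb⟩, ?_⟩⟩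
    have ha : a • σ m = 0 := by
      obtain ⟨x, hx⟩ := Ideal.Quotient.mk_surjective (σ m)
      rw [← hx]
      exact Ideal.Quotient.eq_zero_iff_mem.mpr (Ideal.mul_mem_right _ _
        (Ideal.mem_span_singleton_self a))
    change b • u • π (σ m) = 0
    rw [smul_smul, mul_comm, hc, mul_comm, mul_smul, ← map_smul, ha, map_zero, smul_zero]

/-- Some `s` outside all primes of `𝒫(M)` acts as the sum of a map `ρ : M → M_tor` and a map killing
`M_tor`, so that `ρ` is multiplication by `s` on `M_tor`. -/
lemma PropertyP1.exists_retraction [IsSemisimpleRing (FractionRing A)] (hP1 : PropertyP1 A M)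
    [Module.FinitePresentation A M] :
    ∃ (ρ : M →ₗ[A] Submodule.torsion A M) (s : A), (∀ x : Submodule.torsion A M, ρ x = s • x) ∧
      ∀ q ∈ heightOneTorsionSupport A M, s ∉ q.asIdeal := by
  obtain ⟨s, hsE, hs⟩ := hP1.exists_smul_id_mem
    (Submodule.compatibleMaps ⊤ (Submodule.torsion A M) ⊔
      Submodule.compatibleMaps (Submodule.torsion A M) (⊥ : Submodule A M)) fun P _ hP ↦ by
    obtain ⟨n, a, φ, ψ, s, hs, h⟩ := exists_comp_eq_smul_of_idealsLinearlyOrdered P hP M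
    choose u hu huE using fun i ↦ exists_smul_comp_mem_sup P hP (a i)
      (LinearMap.proj i ∘ₗ φ) (ψ ∘ₗ LinearMap.single A (fun i ↦ A ⧸ Ideal.span {a i}) i)
    refine ⟨(∏ i, u i) * s, P.primeCompl.mul_mem
      (P.primeCompl.prod_mem fun i _ ↦ hu i) hs, ?_⟩
    rw [mul_smul, smul_id_eq_sum φ ψ h, Finset.smul_sum]
    refine Submodule.sum_mem _ fun i _ ↦ ?_
    rw [← Finset.prod_erase_mul _ _ (Finset.mem_univ i), mul_smul]
    exact Submodule.smul_mem _ _ (huE i)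
  obtain ⟨ρ, hρ, g, hg, hρg⟩ := Submodule.mem_sup.mp hsE
  refine ⟨ρ.codRestrict _ fun m ↦ hρ trivial, s, fun x ↦ Subtype.ext ?_, hs⟩
  have hgx : g x = 0 := hg x.2
  simpa [hgx] using LinearMap.congr_fun hρg (x : M)

theorem exists_pseudoIso_torsion_prod_quotient [IsSemisimpleRing (FractionRing A)]
    [Module.FinitePresentation A M] (hP1 : PropertyP1 A M) :
    ∃ f : M →ₗ[A] (Submodule.torsion A M × (M ⧸ Submodule.torsion A M)), IsPseudoIso f := by
  obtain ⟨ρ, s, hρ, hs⟩ := hP1.exists_retraction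
  refine ⟨ρ.prod (Submodule.torsion A M).mkQ, isPseudoIso_of_forall _ (fun p hp m hm ↦ ?_)
    fun p hp ↦ ?_⟩
  · obtain ⟨h1, h2⟩ := Prod.ext_iff.mp hm
    have hmt : m ∈ Submodule.torsion A M := (Submodule.Quotient.mk_eq_zero _).mp h2
    by_cases hpM : p ∈ heightOneTorsionSupport A M
    · exact ⟨s, hs p hpM, congrArg Subtype.val ((hρ ⟨m, hmt⟩).symm.trans h1)⟩
    · exact exists_smul_eq_zero_of_notMem p hp hpM hmt
  · rintro ⟨x, q⟩
    obtain ⟨m, rfl⟩ := Submodule.mkQ_surjective _ q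
    by_cases hpM : p ∈ heightOneTorsionSupport A M
    · refine ⟨s, hs p hpM, s • m + (x - ρ m : Submodule.torsion A M), Prod.ext ?_ ?_⟩
      · change ρ (s • m + (x - ρ m : Submodule.torsion A M)) = s • x
        rw [map_add, map_smul, hρ, smul_sub, add_sub_cancel]
      · change (Submodule.torsion A M).mkQ _ = s • (Submodule.torsion A M).mkQ m
        rw [map_add, map_smul, Submodule.mkQ_apply _ (Subtype.val _),
          (Submodule.Quotient.mk_eq_zero _).mpr (x - ρ m).2, add_zero]
    · obtain ⟨t, ht, h⟩ := exists_smul_eq_zero_of_notMem p hp hpM (x - ρ m).2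
      refine ⟨t, ht, t • m, Prod.ext ?_ (by simp)⟩
      have : t • (x - ρ m) = 0 := Subtype.ext h
      rw [smul_sub, sub_eq_zero] at this
      simp [this]

end Splitting

/-! ### Amenable torsion modules -/

section Amenable

variable {A : Type u} [CommRing A] {M : Type v} [AddCommGroup M] [Module A M]

/-- The local ring of a reduced ring at a finitely generated prime of height one is a discrete
valuation ring if its ideals are linearly ordered: it is then a domain whose only nonzero prime is
principal. -/
lemma isDiscreteValuationRing_localization [IsReduced A] (p : Ideal A) [p.IsPrime]
    (hp : IdealsLinearlyOrdered (Localization.AtPrime p)) (hfg : p.FG) (h1 : p.height = 1) :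
    ∃ _ : IsDomain (Localization.AtPrime p), IsDiscreteValuationRing (Localization.AtPrime p) := by
  have hdom : IsDomain (Localization.AtPrime p) := hp.isDomain
  have hdim : ringKrullDim (Localization.AtPrime p) = 1 := by
    rw [IsLocalization.AtPrime.ringKrullDim_eq_height p, h1]; rfl
  have hmax : (IsLocalRing.maximalIdeal (Localization.AtPrime p)).IsPrincipal := by
    rw [← Localization.AtPrime.map_eq_maximalIdeal]
    exact hp.isPrincipal_of_fg (hfg.map _)
  have hle : Ring.KrullDimLE 1 (Localization.AtPrime p) :=
    Ring.krullDimLE_iff.mpr (by rw [hdim]; rfl)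
  have hpir : IsPrincipalIdealRing (Localization.AtPrime p) := .of_prime fun P hP ↦ by
    obtain rfl | hP0 := eq_or_ne P ⊥
    · infer_instance
    · rwa [IsLocalRing.eq_maximalIdeal (Ring.krullDimLE_one_iff_of_noZeroDivisors.mp hle P hP0 hP)]
  refine ⟨hdom, { not_a_field' := fun h ↦ ?_ }⟩
  have := IsLocalRing.maximalIdeal_height_eq_ringKrullDim (R := Localization.AtPrime p)
  rw [h, Ideal.height_bot, hdim] at this
  exact zero_ne_one this

/-- Up to an element outside `p`, a finitely presented torsion module is a direct sum of modules
`A / p ^ e` at a prime `p` whose local ring is a discrete valuation ring. -/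
lemma exists_comp_eq_smul_pow [IsReduced A] (p : Ideal A) [p.IsPrime]
    (hp : IdealsLinearlyOrdered (Localization.AtPrime p)) (hfg : p.FG) (h1 : p.height = 1)
    [Module.FinitePresentation A M] (hM : Module.IsTorsion A M) :
    ∃ (n : ℕ) (e : Fin n → ℕ), (∀ i, 0 < e i) ∧ ∃ (φ : M →ₗ[A] Π i, A ⧸ p ^ e i)
      (ψ : (Π i, A ⧸ p ^ e i) →ₗ[A] M), ∃ s ∉ p, (∀ m, ψ (φ m) = s • m) ∧
        ∀ y, φ (ψ y) = s • y := by
  obtain ⟨_, _⟩ := isDiscreteValuationRing_localization p hp hfg h1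
  obtain ⟨n, r, hr, ⟨E⟩⟩ := hp.exists_equiv_pi (LocalizedModule p.primeCompl M)
  -- A summand with `r i = 0` is torsion-free, whereas the localisation of `M` is torsion.
  have hr0 (i) : r i ≠ 0 := by
    intro h0
    obtain ⟨⟨m, t⟩, hm⟩ := IsLocalizedModule.mk'_surjective p.primeCompl
      (LocalizedModule.mkLinearMap p.primeCompl M) (E.symm (Pi.single i 1))
    obtain ⟨⟨a, ha⟩, ham⟩ := @hM m
    have h2 : a • E.symm (Pi.single i 1) = 0 := by
      rw [← hm, Function.uncurry_apply_pair, ← IsLocalizedModule.mk'_smul,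
        show a • m = 0 from ham, IsLocalizedModule.mk'_zero]
    have h3 : algebraMap A (Localization.AtPrime p) a • E.symm (Pi.single i 1) = 0 := by
      rw [algebraMap_smul, h2]
    rw [← map_smul, LinearEquiv.map_eq_zero_iff] at h3
    have h4 : Ideal.Quotient.mk (Ideal.span {r i}) (algebraMap A (Localization.AtPrime p) a) = 0 := by
      have := congrFun h3 i
      rw [Pi.smul_apply, Pi.single_eq_same] at this
      rw [← mul_one (algebraMap A (Localization.AtPrime p) a)]
      exact this
    rw [Ideal.Quotient.eq_zero_iff_mem, h0, Ideal.mem_span_singleton, zero_dvd_iff] at h4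
    obtain ⟨u, hu⟩ := (IsLocalization.map_eq_zero_iff p.primeCompl _ _).mp h4
    exact u.2 (by rw [mem_nonZeroDivisors_iff_right.mp ha u hu]; exact p.zero_mem)
  obtain ⟨ϖ, hϖ⟩ := IsDiscreteValuationRing.exists_irreducible (Localization.AtPrime p)
  have hmap (k : ℕ) : Ideal.span {ϖ ^ k} =
      (p ^ k).map (algebraMap A (Localization.AtPrime p)) := by
    rw [Ideal.map_pow, Localization.AtPrime.map_eq_maximalIdeal,
      (IsDiscreteValuationRing.irreducible_iff_uniformizer ϖ).mp hϖ, Ideal.span_singleton_pow]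
  choose e he using fun i ↦ IsDiscreteValuationRing.ideal_eq_span_pow_irreducible
    (s := Ideal.span {r i}) (by simpa using hr0 i) hϖ
  refine ⟨n, e, fun i ↦ Nat.pos_of_ne_zero fun h ↦ hr i ?_,
    exists_comp_eq_smul_of_equiv_pi p (fun i ↦ p ^ e i) (fun i ↦ hfg.pow)
      (E ≪≫ₗ LinearEquiv.piCongrRight fun i ↦
        Submodule.quotEquivOfEq _ _ ((he i).trans (hmap (e i))))⟩
  rw [← Ideal.span_singleton_eq_top, he, h, pow_zero, Ideal.span_singleton_one]

/-- If `𝒫(M)` is finite, then prime avoidance shows that its members are the primes occurring in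
property (P₁). -/
lemma PropertyP1.idealsLinearlyOrdered_of_finite (hP1 : PropertyP1 A M)
    (hfin : (heightOneTorsionSupport A M).Finite) {p : PrimeSpectrum A}
    (hp : p ∈ heightOneTorsionSupport A M) :
    IdealsLinearlyOrdered (Localization.AtPrime p.asIdeal) := by
  refine hP1 p ⟨Set.subset_biUnion_of_mem (u := fun q : PrimeSpectrum A ↦ (q.asIdeal : Set A)) hp,
    fun p' hp' hle ↦ ?_⟩
  obtain ⟨q, hq, hq'⟩ := (Ideal.subset_union_prime_finite hfin p p
    fun q _ _ _ ↦ q.isPrime).mp hp'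
  have : p = q := eq_of_le_of_height_le_one hp.1 hq.1.le (le_trans hle hq')
  exact this ▸ hq'

/-- The local decompositions at the finitely many primes of `𝒫(M)` are put together; they do not
interfere, because `A / q ^ e` vanishes at every prime of height at most one other than `q`. -/
theorem exists_pseudoIso_pi_pow [IsReduced A] [Module.FinitePresentation A M]
    (hP1 : PropertyP1 A M) (hP2 : PropertyP2 A M) (hM : Module.IsTorsion A M) :
    ∃ (n : ℕ) (p : Fin n → PrimeSpectrum A) (e : Fin n → ℕ)
      (f : M →ₗ[A] ⨁ τ : Fin n, (A ⧸ (p τ).asIdeal ^ e τ)),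
      (∀ τ, p τ ∈ heightOneTorsionSupport A M ∧ 0 < e τ) ∧ IsPseudoIso f := by
  classical
  have : Finite (heightOneTorsionSupport A M) := hP2.1
  choose n e he φ ψ s hs hψφ hφψ using fun q : heightOneTorsionSupport A M ↦
    exists_comp_eq_smul_pow (M := M) q.1.asIdeal
      (hP1.idealsLinearlyOrdered_of_finite hP2.1 q.2) (hP2.2 q.1 q.2) q.2.1 hM
  let K := Σ q : heightOneTorsionSupport A M, Fin (n q)
  let F : M →ₗ[A] Π k : K, A ⧸ k.1.1.asIdeal ^ e k.1 k.2 :=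
    .pi fun k ↦ .proj k.2 ∘ₗ φ k.1
  have : Fintype K := Fintype.ofFinite K
  have hF : IsPseudoIso F := by
    refine isPseudoIso_of_forall _ (fun p hp m hm ↦ ?_) fun p hp y ↦ ?_
    · by_cases hpM : p ∈ heightOneTorsionSupport A M
      · refine ⟨s ⟨p, hpM⟩, hs ⟨p, hpM⟩, ?_⟩
        have : φ ⟨p, hpM⟩ m = 0 := funext fun i ↦ congrFun hm ⟨⟨p, hpM⟩, i⟩
        rw [← hψφ, this, map_zero]
      · exact exists_smul_eq_zero_of_notMem p hp hpM ((Submodule.mem_torsion_iff m).mpr (@hM m))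
    -- `u` kills the summands belonging to the primes other than `p`.
    · obtain ⟨u, hu, hukill⟩ : ∃ u ∉ p.asIdeal, ∀ k : K, k.1.1 ≠ p →
          ∀ z : A ⧸ k.1.1.asIdeal ^ e k.1 k.2, u • z = 0 := by
        have (k : K) : ∃ u ∉ p.asIdeal, k.1.1 ≠ p → u ∈ k.1.1.asIdeal ^ e k.1 k.2 := by
          by_cases hk : k.1.1 = p
          · exact ⟨1, p.asIdeal.one_notMem, fun h ↦ (h hk).elim⟩
          · obtain ⟨u, hu, hup⟩ := SetLike.not_le_iff_exists.mp
              fun h ↦ hk (eq_of_le_of_height_le_one k.1.2.1 hp h)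
            exact ⟨u ^ e k.1 k.2, fun h ↦ hup (p.isPrime.mem_of_pow_mem _ h),
              fun _ ↦ Ideal.pow_mem_pow hu _⟩
        choose u hu huk using this
        refine ⟨∏ k, u k, p.asIdeal.primeCompl.prod_mem fun k _ ↦ hu k, fun k hk z ↦ ?_⟩
        obtain ⟨x, hx⟩ := Ideal.Quotient.mk_surjective z
        rw [← hx]
        refine Ideal.Quotient.eq_zero_iff_mem.mpr (Ideal.mul_mem_right _ _ ?_)
        rw [← Finset.prod_erase_mul _ _ (Finset.mem_univ k)]
        exact Ideal.mul_mem_left _ _ (huk k hk)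
      by_cases hpM : p ∈ heightOneTorsionSupport A M
      · let q : heightOneTorsionSupport A M := ⟨p, hpM⟩
        refine ⟨s q * u, p.asIdeal.primeCompl.mul_mem (hs q) hu,
          u • ψ q fun i ↦ y ⟨q, i⟩, funext fun ⟨q', i⟩ ↦ ?_⟩
        by_cases hq : q' = q
        · subst hq
          have : φ q (ψ q fun i ↦ y ⟨q, i⟩) i = s q • y ⟨q, i⟩ := congrFun (hφψ q _) i
          change φ q (u • ψ q fun i ↦ y ⟨q, i⟩) i = (s q * u) • y ⟨q, i⟩
          rw [map_smul, Pi.smul_apply, this, smul_smul, mul_comm]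
        · have hq' : q'.1 ≠ p := fun h ↦ hq (Subtype.ext h)
          change φ q' (u • _) i = (s q * u) • y ⟨q', i⟩
          rw [map_smul, mul_smul, Pi.smul_apply, hukill ⟨q', i⟩ hq', hukill ⟨q', i⟩ hq', smul_zero]
      · refine ⟨u, hu, 0, funext fun k ↦ ?_⟩
        rw [map_zero, Pi.smul_apply, hukill k fun h ↦ hpM (h ▸ k.1.2)]
        rfl
  let ε : Fin (Fintype.card K) ≃ K := (Fintype.equivFin K).symm
  exact ⟨Fintype.card K, fun τ ↦ (ε τ).1.1, fun τ ↦ e (ε τ).1 (ε τ).2, _,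
    fun τ ↦ ⟨(ε τ).1.2, he _ _⟩,
    hF.linearEquiv_comp ((LinearEquiv.piCongrLeft A
      (fun k : K ↦ A ⧸ k.1.1.asIdeal ^ e k.1 k.2) ε).symm ≪≫ₗ
      (DirectSum.linearEquivFunOnFintype A (Fin (Fintype.card K)) _).symm)⟩

end Amenable

end NonNoeth

theorem mainTheorem2 (A : Type u) [CommRing A] (M : Type v) [AddCommGroup M] [Module A M]
    (hfp : Module.FinitePresentation A M) (hP1 : NonNoeth.PropertyP1 A M) :
    (Module.IsTorsion A M →
      ∃ (N : Type u) (_ : AddCommGroup N) (_ : Module A N) (n : ℕ) (L : Fin n → Ideal A)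
        (f : (M × N) →ₗ[A] ⨁ τ : Fin n, (A ⧸ L τ)),
        (∀ τ, (L τ).IsPrincipal) ∧ NonNoeth.IsPseudoIso f) ∧
    (IsSemisimpleRing (FractionRing A) →
      (NonNoeth.IsAmenable A M → Module.IsTorsion A M →
        ∃ (n : ℕ) (p : Fin n → PrimeSpectrum A) (e : Fin n → ℕ)
          (f : M →ₗ[A] ⨁ τ : Fin n, (A ⧸ (p τ).asIdeal ^ e τ)),
          (∀ τ, p τ ∈ NonNoeth.heightOneTorsionSupport A M ∧ 0 < e τ) ∧
            NonNoeth.IsPseudoIso f) ∧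
      (∃ f : M →ₗ[A] (Submodule.torsion A M × (M ⧸ Submodule.torsion A M)),
        NonNoeth.IsPseudoIso f)) := by
  refine ⟨fun hM ↦ NonNoeth.exists_prod_pseudoIso_of_isTorsion hP1 hM, fun hQ ↦
    ⟨fun hA hM ↦ ?_, NonNoeth.exists_pseudoIso_torsion_prod_quotient hP1⟩⟩
  have : IsReduced A := NonNoeth.isReduced_of_isSemisimpleRing_fractionRing
  exact NonNoeth.exists_pseudoIso_pi_pow hP1 hA.p2 hM
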